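/- Let $\nu>-1$ be real. Let $$J_\nu(z)=\left(\frac z2\right)^{\nu}\sum_{k=0}^{\infty}\frac{(-1)^k (z/2)^{2k}}{k!\,\Gamma(\nu+k+1)},\qquad I_\nu(z)=i^{-\nu}J_\nu(iz)$$ be the Bessel function and the modified Bessel function of the first kind (with $1/\Gamma=0$ at the poles of $\Gamma$, and principal powers and roots), and let $$f(z)=\frac{I_\nu(\sqrt z)}{(\sqrt z/2)^{\nu}}\quad(z\ne0),\qquad f(0)=\frac1{\Gamma(\nu+1)}.$$ Then $f$ is an entire function of order $\tfrac12$, that is, $$\limsup_{r\to\infty}\frac{\log\log\max_{|z|\le r}|f(z)|}{\log r}=\frac12,$$ and every zero of $f$ is a negative real number. For every $x>0$, $$\frac{f'(x)}{f(x)}=\frac{I_{\nu-1}(\sqrt x)}{2\sqrt x\,I_\nu(\sqrt x)}-\frac{\nu}{x}\in\mathbb R .$$ Moreover, for every $\rho$ with $\tfrac12<\rho<1$, the integral $$\int_0^\infty\left(\frac{I_{\nu-1}(\sqrt x)}{2\sqrt x\,I_\nu(\sqrt x)}-\frac{\nu}{x}\right)\frac{dx}{x^\rho}$$ converges absolutely,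 and for every $z\in\mathbb C$ with $|\arg z|<\tfrac\pi2$ (where $\arg 0=0$), $$1\le\Gamma(\nu+1)\,|f(z)|=\Gamma(\nu+1)\left|\frac{I_\nu(\sqrt z)}{(\sqrt z/2)^\nu}\right|\le\exp\bigl(a_\rho(\nu,z)\,|z|^\rho\bigr)$$ (the middle expression being read as its limit at $z=0$), where $$a_\rho(\nu,z)=\frac{(\rho/e)^\rho}{\cos^{1-\rho}(\arg z)\,\Gamma(1+\rho)}\int_0^\infty\left(\frac{I_{\nu-1}(\sqrt x)}{2\sqrt x\,I_\nu(\sqrt x)}-\frac{\nu}{x}\right)\frac{dx}{x^\rho}.$$ -/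

import Mathlib

open Filter Set MeasureTheory
open scoped Nat

/-- The order of growth of an entire function `f`, that is
`limsup_{r → ∞} log (log M(r)) / log r` with `M(r) = max {|f z| : |z| ≤ r}`, as an extended real.
For a nonconstant entire function `log M(r)` is positive for all large `r`; the conventions for
`Real.log` give a constant function the order `0`. -/
noncomputable def entireOrder (f : ℂ → ℂ) : EReal :=
  limsup (fun r : ℝ =>
    ((Real.log (Real.log (sSup ((fun z : ℂ => ‖f z‖) '' Metric.closedBall 0 r))) / Real.log r : ℝ) :
      EReal)) atTop

/-- The Bessel function of the first kind
`J_ν(z) = (z/2)^ν ∑ (-1)^k (z/2)^(2k) / (k! Γ(ν+k+1))`, with the principal branch of the power.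
At the poles of `Γ` the value `0` of `Complex.Gamma` gives the usual convention `1/Γ = 0`. -/
noncomputable def besselJ (ν : ℝ) (z : ℂ) : ℂ :=
  (z / 2) ^ (ν : ℂ) *
    ∑' k : ℕ, (-1) ^ k * (z / 2) ^ (2 * k) / ((k ! : ℂ) * Complex.Gamma (ν + k + 1))

/-- The modified Bessel function of the first kind, `I_ν(z) = i^(-ν) J_ν(i z)`. With principal
powers this is the principal branch of `I_ν` for `-π < arg z ≤ π/2`, which contains every principal
square root. -/
noncomputable def besselI (ν : ℝ) (z : ℂ) : ℂ :=
  Complex.I ^ (-(ν : ℂ)) * besselJ ν (Complex.I * z)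

/-- `f(z) = I_ν(√z) / (√z/2)^ν`, with the principal square root, and with the value
`1 / Γ(ν+1)` at the removable singularity `z = 0`. -/
noncomputable def besselIQuot (ν : ℝ) : ℂ → ℂ :=
  Function.update
    (fun z : ℂ => besselI ν (Complex.sqrt z) / (Complex.sqrt z / 2) ^ (ν : ℂ))
    0 (1 / Complex.Gamma (ν + 1))

/-- `I_{ν-1}(√x) / (2 √x I_ν(√x)) - ν / x` for real `x > 0`. All the values of `I` here are real;
the real part only turns the complex expression into a real number. -/
noncomputable def besselILogDeriv (ν x : ℝ) : ℝ :=
  (besselI (ν - 1) (√x : ℝ) / (2 * (√x : ℝ) * besselI ν (√x : ℝ)) - ν / x : ℂ).re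

/-- The coefficient `a_ρ(ν, z)` of the exponential bound. -/
noncomputable def besselIBoundCoeff (ρ ν : ℝ) (z : ℂ) : ℝ :=
  (ρ / Real.exp 1) ^ ρ / (Real.cos z.arg ^ (1 - ρ) * Real.Gamma (1 + ρ)) *
    ∫ x in Ioi (0 : ℝ), besselILogDeriv ν x / x ^ ρ

/-! Write F_ν for `besselSeries ν`. Cancelling the power of √z shows f = F_ν, so f is entire.
Everything then rests on two relations: F_ν' = F_{ν+1}/4 and F_ν = (ν+1)F_{ν+1} + (z/4)F_{ν+2}.
Together they give the self-adjoint form (r^{ν+1} F_{ν+1}(rz))' = r^ν F_ν(rz) along each ray.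

Zeros and lower bound: the flux Φ(r) = conj(F_ν(rz)) · z r^{ν+1} F_{ν+1}(rz) vanishes at r = 0 and
satisfies Φ' = |z|² r^{ν+1}|F_{ν+1}|²/4 + z r^ν|F_ν|². If Re z ≥ 0, then Re Φ ≥ 0, which says that
|F_ν(rz)| increases with r. If F_ν(z) = 0, then Φ(1) = 0, and Im Φ forces Im z = 0; positivity on
[0,∞) leaves only negative zeros.

Upper bound: g = F_ν'/F_ν on [0,∞) solves the Riccati equation x g' = 1/4 - (ν+1)g - x g². Two
quadratic inequalities for g show that g decreases, that x g(x) increases, and that g is comparable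
to x^{-1/2} at infinity. The last fact gives the order 1/2 and the convergence of the integral.
Since the coefficients are positive, |F_ν(z)| ≤ F_ν(|z|), and log(Γ(ν+1)F_ν(r)) = ∫₀ʳ g. The two
monotonicities bound this by the weighted integral of g (`integral_le_of_antitoneOn_of_monotoneOn`).
The factor cos^{1-ρ}(arg z) ≤ 1 only enlarges the bound. -/

/-! ### The entire series and its contiguous relations -/

/-- The coefficient `1 / (k! Γ(ν+k+1))`. -/
noncomputable def besselCoeff (ν : ℝ) (k : ℕ) : ℂ := 1 / ((k ! : ℂ) * Complex.Gamma (ν + k + 1))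

/-- The entire function `∑ (z/4)^k / (k! Γ(ν+k+1))`. -/
noncomputable def besselSeries (ν : ℝ) (z : ℂ) : ℂ := ∑' k : ℕ, besselCoeff ν k * (z / 4) ^ k

lemma besselCoeff_add_one (ν : ℝ) (k : ℕ) :
    besselCoeff (ν + 1) k = (k + 1) * besselCoeff ν (k + 1) := by
  have h : ((ν + 1 : ℝ) : ℂ) + k + 1 = ν + (k + 1 : ℕ) + 1 := by push_cast; ring
  have hk : (k : ℂ) + 1 ≠ 0 := by exact_mod_cast Nat.succ_ne_zero k
  have hf : (k ! : ℂ) ≠ 0 := by exact_mod_cast Nat.factorial_ne_zero k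
  rw [besselCoeff, besselCoeff, h, Nat.factorial_succ]
  push_cast
  rw [mul_assoc, one_div, one_div, mul_inv, mul_inv, mul_inv, mul_inv_cancel_left₀ hk]

/-- No condition on ν is needed: 1/Γ(s) = s/Γ(s+1) survives at the poles with the convention 1/Γ =
0. This matters for I_{ν-1} when ν = 0. -/
lemma besselCoeff_eq (ν : ℝ) (k : ℕ) :
    besselCoeff ν k = (ν + k + 1) * besselCoeff (ν + 1) k := by
  have h : ((ν + 1 : ℝ) : ℂ) + k + 1 = (ν + k + 1) + 1 := by push_cast; ring
  have := Complex.one_div_Gamma_eq_self_mul_one_div_Gamma_add_one (ν + k + 1 : ℂ)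
  rw [besselCoeff, besselCoeff, h, one_div, mul_inv, one_div, mul_inv, this]
  ring

lemma besselCoeff_recurrence (ν : ℝ) (k : ℕ) :
    (ν + k + 1) * (k + 1) * besselCoeff ν (k + 1) = besselCoeff ν k := by
  rw [besselCoeff_eq ν k, besselCoeff_add_one]; ring

lemma summable_besselCoeff (ν : ℝ) (w : ℂ) : Summable fun k : ℕ => besselCoeff ν k * w ^ k := by
  refine summable_of_ratio_norm_eventually_le (r := 1 / 2) (by norm_num) ?_
  -- From this index on, ν+k+1 ≥ 1 and k+1 ≥ 2‖w‖, so consecutive terms have ratio at most 1/2.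
  filter_upwards [eventually_ge_atTop (⌈|ν|⌉₊ + ⌈2 * ‖w‖⌉₊)] with k hk
  have h1 : |ν| + 2 * ‖w‖ ≤ k := by
    have := (Nat.cast_le (α := ℝ)).2 hk
    push_cast at this
    linarith [Nat.le_ceil |ν|, Nat.le_ceil (2 * ‖w‖)]
  have h2 : 1 ≤ ν + k + 1 := by linarith [neg_abs_le ν, norm_nonneg w]
  have h3 : 2 * ‖w‖ ≤ (ν + k + 1) * (k + 1) := by
    nlinarith [abs_nonneg ν, norm_nonneg w, (Nat.cast_nonneg k : (0 : ℝ) ≤ k)]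
  have h4 : (ν + k + 1) * (k + 1) * ‖besselCoeff ν (k + 1)‖ = ‖besselCoeff ν k‖ := by
    rw [← besselCoeff_recurrence ν k, norm_mul]
    congr 1
    rw [show ((ν : ℂ) + k + 1) * (k + 1) = ((ν + k + 1) * (k + 1) : ℝ) by push_cast; ring,
      Complex.norm_of_nonneg (by positivity)]
  rw [norm_mul, norm_mul, norm_pow, norm_pow, ← h4, pow_succ]
  have h5 : 0 ≤ ‖besselCoeff ν (k + 1)‖ * ‖w‖ ^ k := by positivity
  nlinarith

lemma hasDerivAt_besselSeries (ν : ℝ) (z : ℂ) :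
    HasDerivAt (besselSeries ν) (besselSeries (ν + 1) z / 4) z := by
  set M : ℝ := ‖z‖ + 1 with hM
  have hM0 : 0 < M := by positivity
  have key : HasDerivAt (fun y : ℂ => ∑' k : ℕ, besselCoeff ν k * (y / 4) ^ k)
      (∑' k : ℕ, besselCoeff ν k * (k * (z / 4) ^ (k - 1) * (1 / 4))) z := by
    refine hasDerivAt_tsum_of_isPreconnected
      (g := fun (k : ℕ) (y : ℂ) => besselCoeff ν k * (y / 4) ^ k)
      (g' := fun (k : ℕ) (y : ℂ) => besselCoeff ν k * (k * (y / 4) ^ (k - 1) * (1 / 4)))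
      (u := fun k : ℕ => ‖besselCoeff ν k * (k * ((M : ℂ) / 4) ^ (k - 1) * (1 / 4))‖)
      (t := Metric.ball (0 : ℂ) M) (y₀ := z) ?_ Metric.isOpen_ball
      (convex_ball (0 : ℂ) M).isPreconnected ?_ ?_ ?_ ?_ ?_
    · rw [← summable_nat_add_iff 1]
      refine ((summable_besselCoeff (ν + 1) ((M : ℂ) / 4)).norm.mul_right (1 / 4)).congr fun k => ?_
      rw [besselCoeff_add_one]
      simp only [norm_mul, Nat.add_sub_cancel, norm_pow]
      push_cast
      norm_num
      ring
    · intro k y _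
      exact (((hasDerivAt_id y).div_const 4).pow k).const_mul _
    · intro k y hy
      have : ‖y‖ ≤ M := by simpa using (Metric.mem_ball.1 hy).le
      simp only [norm_mul, norm_pow, norm_div, Complex.norm_of_nonneg hM0.le]
      gcongr
    · simp [hM]
    · exact summable_besselCoeff ν _
    · simp [hM]
  refine HasDerivAt.congr_deriv key ?_
  have hs : Summable fun k : ℕ => besselCoeff ν k * (k * (z / 4) ^ (k - 1) * (1 / 4)) := by
    rw [← summable_nat_add_iff 1]
    refine ((summable_besselCoeff (ν + 1) (z / 4)).mul_right (1 / 4)).congr fun k => ?_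
    rw [besselCoeff_add_one, Nat.add_sub_cancel]
    push_cast
    ring
  rw [hs.tsum_eq_zero_add, besselSeries, div_eq_mul_one_div (tsum _), ← tsum_mul_right]
  simp only [Nat.cast_zero, zero_mul, mul_zero, zero_add]
  refine tsum_congr fun k => ?_
  rw [besselCoeff_add_one, Nat.add_sub_cancel]
  push_cast
  ring

lemma besselSeries_eq_add (ν : ℝ) (z : ℂ) :
    besselSeries ν z = (ν + 1) * besselSeries (ν + 1) z + z / 4 * besselSeries (ν + 1 + 1) z := by
  have h1 := summable_besselCoeff (ν + 1) (z / 4)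
  have h2 := summable_besselCoeff (ν + 1 + 1) (z / 4)
  have h3 : Summable fun k : ℕ => besselCoeff (ν + 1) k * k * (z / 4) ^ k := by
    rw [← summable_nat_add_iff 1]
    refine (h2.mul_left (z / 4)).congr fun k => ?_
    rw [besselCoeff_add_one (ν + 1)]
    push_cast
    ring
  have h4 : ∑' k : ℕ, besselCoeff (ν + 1) k * k * (z / 4) ^ k
      = z / 4 * besselSeries (ν + 1 + 1) z := by
    rw [h3.tsum_eq_zero_add, besselSeries, ← tsum_mul_left]
    simp only [Nat.cast_zero, zero_mul, mul_zero, zero_add]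
    refine tsum_congr fun k => ?_
    rw [besselCoeff_add_one (ν + 1)]
    push_cast
    ring
  rw [← h4, besselSeries, besselSeries, ← tsum_mul_left, ← (h1.mul_left _).tsum_add h3]
  refine tsum_congr fun k => ?_
  rw [besselCoeff_eq]
  ring

lemma besselSeries_zero (ν : ℝ) : besselSeries ν 0 = 1 / Complex.Gamma (ν + 1) := by
  rw [besselSeries, tsum_eq_single 0 (fun k hk => by simp [hk])]
  simp [besselCoeff]

/-! ### Restriction to the real axis and positivity -/

lemma besselCoeff_eq_ofReal (ν : ℝ) (k : ℕ) :
    besselCoeff ν k = ((1 / (k ! * Real.Gamma (ν + k + 1)) : ℝ) : ℂ) := by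
  rw [besselCoeff, show (ν + k + 1 : ℂ) = ((ν + k + 1 : ℝ) : ℂ) by push_cast; ring,
    Complex.Gamma_ofReal]
  push_cast
  ring

/-- The function `∑ (x/4)^k / (k! Γ(ν+k+1))` of a real variable. -/
noncomputable def besselSeriesReal (ν x : ℝ) : ℝ :=
  ∑' k : ℕ, 1 / (k ! * Real.Gamma (ν + k + 1)) * (x / 4) ^ k

lemma ofReal_besselSeriesReal (ν x : ℝ) : (besselSeriesReal ν x : ℂ) = besselSeries ν x := by
  rw [besselSeriesReal, besselSeries, Complex.ofReal_tsum]
  refine tsum_congr fun k => ?_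
  rw [besselCoeff_eq_ofReal]
  push_cast
  ring

lemma summable_besselSeriesReal (ν x : ℝ) :
    Summable fun k : ℕ => 1 / (k ! * Real.Gamma (ν + k + 1)) * (x / 4) ^ k := by
  rw [← Complex.summable_ofReal]
  refine (summable_besselCoeff ν (x / 4)).congr fun k => ?_
  rw [besselCoeff_eq_ofReal]
  push_cast
  ring

lemma hasDerivAt_besselSeriesReal (ν x : ℝ) :
    HasDerivAt (besselSeriesReal ν) (besselSeriesReal (ν + 1) x / 4) x := by
  have h := (hasDerivAt_besselSeries ν x).real_of_complex
  rw [← ofReal_besselSeriesReal] at h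
  simp only [← ofReal_besselSeriesReal, Complex.ofReal_re] at h
  convert h using 1
  rw [show ((besselSeriesReal (ν + 1) x : ℂ) / 4) = ((besselSeriesReal (ν + 1) x / 4 : ℝ) : ℂ) by
    push_cast; ring, Complex.ofReal_re]

lemma besselSeriesReal_eq_add (ν x : ℝ) :
    besselSeriesReal ν x =
      (ν + 1) * besselSeriesReal (ν + 1) x + x / 4 * besselSeriesReal (ν + 1 + 1) x := by
  have := besselSeries_eq_add ν x
  simp only [← ofReal_besselSeriesReal] at this
  exact_mod_cast this

lemma besselSeriesReal_zero (ν : ℝ) : besselSeriesReal ν 0 = 1 / Real.Gamma (ν + 1) := by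
  rw [besselSeriesReal, tsum_eq_single 0 (fun k hk => by simp [hk])]
  simp

lemma besselSeriesReal_coeff_pos {ν : ℝ} (hν : -1 < ν) (k : ℕ) :
    0 < 1 / (k ! * Real.Gamma (ν + k + 1)) := by
  have : 0 < Real.Gamma (ν + k + 1) :=
    Real.Gamma_pos_of_pos (by linarith [(Nat.cast_nonneg k : (0 : ℝ) ≤ k)])
  positivity

lemma besselSeriesReal_pos {ν x : ℝ} (hν : -1 < ν) (hx : 0 ≤ x) : 0 < besselSeriesReal ν x := by
  refine (summable_besselSeriesReal ν x).tsum_pos (fun k => ?_) 0 ?_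
  · exact mul_nonneg (besselSeriesReal_coeff_pos hν k).le (by positivity)
  · simpa using besselSeriesReal_coeff_pos hν 0

lemma norm_besselSeries_le {ν : ℝ} (hν : -1 < ν) (z : ℂ) :
    ‖besselSeries ν z‖ ≤ besselSeriesReal ν ‖z‖ := by
  refine tsum_of_norm_bounded (summable_besselSeriesReal ν ‖z‖).hasSum fun k => ?_
  rw [besselCoeff_eq_ofReal, norm_mul, norm_pow, norm_div,
    Complex.norm_of_nonneg (besselSeriesReal_coeff_pos hν k).le]
  norm_num

lemma norm_besselSeries_ofReal {ν x : ℝ} (hν : -1 < ν) (hx : 0 ≤ x) :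
    ‖besselSeries ν x‖ = besselSeriesReal ν x := by
  rw [← ofReal_besselSeriesReal, Complex.norm_of_nonneg (besselSeriesReal_pos hν hx).le]

lemma continuous_besselSeries (ν : ℝ) : Continuous (besselSeries ν) :=
  continuous_iff_continuousAt.2 fun z => (hasDerivAt_besselSeries ν z).continuousAt

lemma continuous_besselSeriesReal (ν : ℝ) : Continuous (besselSeriesReal ν) :=
  continuous_iff_continuousAt.2 fun x => (hasDerivAt_besselSeriesReal ν x).continuousAt

/-! ### Identification with the Bessel functions -/

/-- The condition on arg w keeps arg i + arg w in (0, π], so the principal power of iw/2 splits and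
i^{-ν} cancels. -/
lemma besselI_eq (ν : ℝ) {w : ℂ} (hw : w ≠ 0) (h1 : -(Real.pi / 2) < w.arg)
    (h2 : w.arg ≤ Real.pi / 2) :
    besselI ν w = (w / 2) ^ (ν : ℂ) * besselSeries ν (w ^ 2) := by
  have hw2 : w / 2 ≠ 0 := div_ne_zero hw two_ne_zero
  have harg : (w / 2).arg = w.arg := by
    rw [div_eq_inv_mul, show (2 : ℂ)⁻¹ = ((2⁻¹ : ℝ) : ℂ) by push_cast; rfl]
    exact Complex.arg_real_mul _ (by norm_num)
  have hpow : (Complex.I * w / 2) ^ (ν : ℂ) = Complex.I ^ (ν : ℂ) * (w / 2) ^ (ν : ℂ) := by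
    rw [mul_div_assoc, Complex.cpow_def_of_ne_zero (mul_ne_zero Complex.I_ne_zero hw2),
      Complex.cpow_def_of_ne_zero Complex.I_ne_zero, Complex.cpow_def_of_ne_zero hw2,
      ← Complex.exp_add, ← add_mul, Complex.log_mul Complex.I_ne_zero hw2]
    rw [Complex.arg_I, harg]
    constructor <;> linarith [Real.pi_pos]
  have hI : Complex.I ^ (-(ν : ℂ)) * Complex.I ^ (ν : ℂ) = 1 := by
    rw [← Complex.cpow_add _ _ Complex.I_ne_zero]; simp
  rw [besselI, besselJ, hpow, mul_assoc, ← mul_assoc, ← mul_assoc, hI, one_mul, besselSeries]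
  congr 1
  refine tsum_congr fun k => ?_
  rw [besselCoeff, pow_mul, show (Complex.I * w / 2) ^ 2 = -1 * (w ^ 2 / 4) by
    rw [← Complex.I_sq]; ring, mul_pow, ← mul_assoc, ← mul_pow]
  norm_num
  ring

lemma besselIQuot_eq (ν : ℝ) : besselIQuot ν = besselSeries ν := by
  funext z
  rcases eq_or_ne z 0 with rfl | hz
  · rw [besselIQuot, Function.update_self, besselSeries_zero]
  · have hsq : Complex.sqrt z ^ 2 = z := by
      rw [Complex.sqrt, ← Complex.cpow_nat_mul]; norm_num
    have hs0 : Complex.sqrt z ≠ 0 := fun h => hz (by rw [← hsq, h]; norm_num)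
    have harg : (Complex.sqrt z).arg = z.arg / 2 := by
      have him : (Complex.log z * 2⁻¹).im = z.arg / 2 := by
        rw [show (2⁻¹ : ℂ) = ((2⁻¹ : ℝ) : ℂ) by push_cast; rfl, Complex.im_mul_ofReal,
          Complex.log_im, div_eq_mul_inv]
      rw [Complex.sqrt, Complex.cpow_def_of_ne_zero hz, ← Complex.log_im, Complex.log_exp, him]
      · rw [him]; linarith [Complex.neg_pi_lt_arg z, Real.pi_pos]
      · rw [him]; linarith [Complex.arg_le_pi z, Real.pi_pos]
    have hpow : (Complex.sqrt z / 2) ^ (ν : ℂ) ≠ 0 := by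
      rw [Ne, Complex.cpow_eq_zero_iff]
      exact fun h => div_ne_zero hs0 two_ne_zero h.1
    rw [besselIQuot, Function.update_of_ne hz, besselI_eq ν hs0, hsq, mul_div_cancel_left₀ _ hpow]
    · rw [harg]; linarith [Complex.neg_pi_lt_arg z]
    · rw [harg]; linarith [Complex.arg_le_pi z]

lemma besselI_sqrt (ν : ℝ) {x : ℝ} (hx : 0 < x) :
    besselI ν (√x : ℝ) = ((√x / 2 : ℝ) : ℂ) ^ (ν : ℂ) * besselSeries ν x := by
  have hs : 0 < √x := Real.sqrt_pos.2 hx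
  have h0 : ((√x : ℝ) : ℂ).arg = 0 := Complex.arg_ofReal_of_nonneg hs.le
  rw [besselI_eq ν (by exact_mod_cast hs.ne') (by rw [h0]; linarith [Real.pi_pos])
    (by rw [h0]; linarith [Real.pi_pos]), ← Complex.ofReal_pow, Real.sq_sqrt hx.le]
  push_cast
  rfl

/-- The logarithmic derivative of `besselSeriesReal ν`. -/
noncomputable def besselSeriesLogDeriv (ν x : ℝ) : ℝ :=
  besselSeriesReal (ν + 1) x / (4 * besselSeriesReal ν x)

/-- The relation F_{ν-1} = νF_ν + (x/4)F_{ν+1}, divided by xF_ν, produces exactly the term ν/x that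
is subtracted. -/
lemma besselI_div_sub_eq {ν x : ℝ} (hν : -1 < ν) (hx : 0 < x) :
    besselI (ν - 1) (√x : ℝ) / (2 * (√x : ℝ) * besselI ν (√x : ℝ)) - ν / x =
      (besselSeriesLogDeriv ν x : ℂ) := by
  have hs : 0 < √x := Real.sqrt_pos.2 hx
  have hs2 : ((√x / 2 : ℝ) : ℂ) ≠ 0 := by exact_mod_cast (by positivity : √x / 2 ≠ 0)
  have hpow : ((√x / 2 : ℝ) : ℂ) ^ (ν : ℂ) ≠ 0 := by
    rw [Ne, Complex.cpow_eq_zero_iff]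
    exact fun h => hs2 h.1
  have hR : besselSeries ν x ≠ 0 := by
    rw [← ofReal_besselSeriesReal]
    exact_mod_cast (besselSeriesReal_pos hν hx.le).ne'
  have hxc : (x : ℂ) ≠ 0 := by exact_mod_cast hx.ne'
  have hsx : (((√x / 2 : ℝ) : ℂ)) * (2 * (√x : ℝ)) = x := by
    have : √x / 2 * (2 * √x) = x := by nlinarith [Real.sq_sqrt hx.le]
    exact_mod_cast this
  have hrec := besselSeries_eq_add (ν - 1) x
  rw [sub_add_cancel] at hrec
  push_cast at hrec
  rw [sub_add_cancel] at hrec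
  have hcancel : besselI (ν - 1) (√x : ℝ) / (2 * (√x : ℝ) * besselI ν (√x : ℝ)) =
      besselSeries (ν - 1) x / (x * besselSeries ν x) := by
    rw [besselI_sqrt _ hx, besselI_sqrt _ hx]
    push_cast
    rw [Complex.cpow_sub _ _ (by simpa using hs2), Complex.cpow_one]
    rw [← hsx] at hxc ⊢
    have h4 : ((√x : ℝ) : ℂ) ≠ 0 := by exact_mod_cast hs.ne'
    push_cast at hpow ⊢
    field_simp
  rw [hcancel, hrec, besselSeriesLogDeriv]
  push_cast
  rw [ofReal_besselSeriesReal, ofReal_besselSeriesReal]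
  field_simp
  ring

lemma besselILogDeriv_eq {ν x : ℝ} (hν : -1 < ν) (hx : 0 < x) :
    besselILogDeriv ν x = besselSeriesLogDeriv ν x := by
  rw [besselILogDeriv, besselI_div_sub_eq hν hx, Complex.ofReal_re]

lemma logDeriv_besselSeries_ofReal (ν x : ℝ) :
    logDeriv (besselSeries ν) x = (besselSeriesLogDeriv ν x : ℂ) := by
  rw [logDeriv_apply, (hasDerivAt_besselSeries ν x).deriv, besselSeriesLogDeriv]
  push_cast
  rw [ofReal_besselSeriesReal, ofReal_besselSeriesReal, div_div]

/-! ### Flux along rays: lower bound and location of zeros -/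

lemma monotoneOn_Ici_of_hasDerivAt_nonneg {f f' : ℝ → ℝ} {a : ℝ} (hc : ContinuousOn f (Ici a))
    (hd : ∀ x, a < x → HasDerivAt f (f' x) x) (hf' : ∀ x, a < x → 0 ≤ f' x) :
    MonotoneOn f (Ici a) := by
  refine monotoneOn_of_deriv_nonneg (convex_Ici a) hc ?_ ?_
  · intro x hx
    rw [interior_Ici] at hx
    exact (hd x hx).differentiableAt.differentiableWithinAt
  · intro x hx
    rw [interior_Ici] at hx
    rw [(hd x hx).deriv]
    exact hf' x hx

lemma hasDerivAt_besselSeries_ray (ν : ℝ) (z : ℂ) (r : ℝ) :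
    HasDerivAt (fun r : ℝ => besselSeries ν (r * z)) (z * besselSeries (ν + 1) (r * z) / 4) r := by
  have h1 : HasDerivAt (fun w : ℂ => w * z) z (r : ℂ) := by
    simpa using (hasDerivAt_id (r : ℂ)).mul_const z
  have h2 := ((hasDerivAt_besselSeries ν (r * z)).comp (r : ℂ) h1).comp_ofReal
  refine HasDerivAt.congr_deriv h2 ?_
  ring

lemma hasDerivAt_rpow_mul_besselSeries_ray (ν : ℝ) (z : ℂ) {r : ℝ} (hr : 0 < r) :
    HasDerivAt (fun r : ℝ => ((r ^ (ν + 1) : ℝ) : ℂ) * besselSeries (ν + 1) (r * z))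
      (((r ^ ν : ℝ) : ℂ) * besselSeries ν (r * z)) r := by
  have h1 := (Real.hasDerivAt_rpow_const (p := ν + 1) (Or.inl hr.ne')).ofReal_comp
  have h2 := h1.mul (hasDerivAt_besselSeries_ray (ν + 1) z r)
  refine HasDerivAt.congr_deriv h2 ?_
  rw [besselSeries_eq_add ν, add_sub_cancel_right, Real.rpow_add_one hr.ne']
  push_cast
  ring

/-- The flux `r^(ν+1) · conj F(r) · z · S(r)` along the ray through `z`. -/
noncomputable def besselFlux (ν : ℝ) (z : ℂ) (r : ℝ) : ℂ :=
  star (besselSeries ν (r * z)) *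
    (z * (((r ^ (ν + 1) : ℝ) : ℂ) * besselSeries (ν + 1) (r * z)))

lemma hasDerivAt_besselFlux (ν : ℝ) (z : ℂ) {r : ℝ} (hr : 0 < r) :
    HasDerivAt (besselFlux ν z)
      (((r ^ (ν + 1) * (Complex.normSq z * Complex.normSq (besselSeries (ν + 1) (r * z)) / 4) : ℝ)
        : ℂ) + z * ((r ^ ν * Complex.normSq (besselSeries ν (r * z)) : ℝ) : ℂ)) r := by
  have h := (hasDerivAt_besselSeries_ray ν z r).star.mul
    ((hasDerivAt_rpow_mul_besselSeries_ray ν z hr).const_mul z)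
  refine HasDerivAt.congr_deriv h ?_
  push_cast
  rw [Complex.normSq_eq_conj_mul_self, Complex.normSq_eq_conj_mul_self,
    Complex.normSq_eq_conj_mul_self]
  simp only [Complex.star_def, map_div₀, map_mul, map_ofNat]
  ring

lemma continuous_besselFlux {ν : ℝ} (hν : -1 < ν) (z : ℂ) : Continuous (besselFlux ν z) := by
  have h1 : Continuous fun r : ℝ => r ^ (ν + 1) :=
    continuous_id.rpow_const fun _ => Or.inr (by linarith)
  have h2 := continuous_besselSeries ν
  have h3 := continuous_besselSeries (ν + 1)
  unfold besselFlux
  fun_prop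

lemma besselFlux_zero {ν : ℝ} (hν : -1 < ν) (z : ℂ) : besselFlux ν z 0 = 0 := by
  simp [besselFlux, Real.zero_rpow (by linarith : ν + 1 ≠ 0)]

lemma re_besselFlux_nonneg {ν : ℝ} (hν : -1 < ν) {z : ℂ} (hz : 0 ≤ z.re) {r : ℝ} (hr : 0 ≤ r) :
    0 ≤ (besselFlux ν z r).re := by
  have hmono : MonotoneOn (fun r => (besselFlux ν z r).re) (Ici 0) := by
    refine monotoneOn_Ici_of_hasDerivAt_nonneg
      (Complex.continuous_re.comp (continuous_besselFlux hν z)).continuousOn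
      (fun x hx => Complex.reCLM.hasFDerivAt.comp_hasDerivAt x (hasDerivAt_besselFlux ν z hx))
      fun x hx => ?_
    rw [Complex.reCLM_apply, Complex.add_re, Complex.ofReal_re, Complex.re_mul_ofReal]
    have := Complex.normSq_nonneg z
    have := Complex.normSq_nonneg (besselSeries (ν + 1) (x * z))
    have := Complex.normSq_nonneg (besselSeries ν (x * z))
    positivity
  have := hmono self_mem_Ici (mem_Ici.2 hr) hr
  simpa [besselFlux_zero hν] using this

/-- The derivative of |F_ν(rz)|² is Re Φ(r) / (2 r^{ν+1}), where Φ is the flux, and Re Φ ≥ 0. -/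
lemma norm_besselSeries_zero_le {ν : ℝ} (hν : -1 < ν) {z : ℂ} (hz : 0 ≤ z.re) :
    ‖besselSeries ν 0‖ ≤ ‖besselSeries ν z‖ := by
  have hmono : MonotoneOn (fun r : ℝ => ‖besselSeries ν (r * z)‖ ^ 2) (Ici 0) := by
    have hcont : Continuous fun r : ℝ => ‖besselSeries ν (r * z)‖ ^ 2 := by
      have := continuous_besselSeries ν
      fun_prop
    refine monotoneOn_Ici_of_hasDerivAt_nonneg hcont.continuousOn
      (fun x _ => (hasDerivAt_besselSeries_ray ν z x).norm_sq) fun x hx => ?_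
    have h1 := re_besselFlux_nonneg hν hz (le_of_lt hx)
    have h2 : (besselFlux ν z x).re = x ^ (ν + 1) *
        (star (besselSeries ν (x * z)) * (z * besselSeries (ν + 1) (x * z))).re := by
      rw [← Complex.re_ofReal_mul, besselFlux]
      congr 1
      ring
    have h3 := nonneg_of_mul_nonneg_right (h2 ▸ h1) (Real.rpow_pos_of_pos hx _)
    have h4 : inner ℝ (besselSeries ν (x * z)) (z * besselSeries (ν + 1) (x * z) / 4) =
        (star (besselSeries ν (x * z)) * (z * besselSeries (ν + 1) (x * z))).re / 4 := by
      rw [Complex.inner]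
      simp only [Complex.star_def, Complex.mul_re, Complex.div_ofNat_re, Complex.div_ofNat_im]
      ring
    rw [h4]
    positivity
  have := hmono self_mem_Ici (mem_Ici.2 zero_le_one) zero_le_one
  simp only [Complex.ofReal_zero, zero_mul, Complex.ofReal_one, one_mul] at this
  exact (sq_le_sq₀ (norm_nonneg _) (norm_nonneg _)).1 this

lemma im_eq_zero_of_besselSeries_eq_zero {ν : ℝ} (hν : -1 < ν) {z : ℂ}
    (hz : besselSeries ν z = 0) : z.im = 0 := by
  by_contra him
  -- The factor `z.im` makes U increasing whatever the sign of Im z.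
  set U : ℝ → ℝ := fun r => z.im * (besselFlux ν z r).im with hU
  have hd : ∀ x : ℝ, 0 < x →
      HasDerivAt U (z.im ^ 2 * (x ^ ν * Complex.normSq (besselSeries ν (x * z)))) x := by
    intro x hx
    have h := (Complex.imCLM.hasFDerivAt.comp_hasDerivAt x
      (hasDerivAt_besselFlux ν z hx)).const_mul z.im
    refine HasDerivAt.congr_deriv h ?_
    rw [Complex.imCLM_apply, Complex.add_im, Complex.ofReal_im, Complex.im_mul_ofReal]
    ring
  have hmono : MonotoneOn U (Ici 0) := by
    refine monotoneOn_Ici_of_hasDerivAt_nonneg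
      ((Complex.continuous_im.comp (continuous_besselFlux hν z)).const_mul _).continuousOn hd
      fun x hx => ?_
    have := Complex.normSq_nonneg (besselSeries ν (x * z))
    positivity
  have hU0 : U 0 = 0 := by simp [hU, besselFlux_zero hν]
  have hU1 : U 1 = 0 := by simp [hU, besselFlux, hz]
  have hUz : ∀ x ∈ Ioo (0 : ℝ) 1, U x = 0 := fun x hx => le_antisymm
    (hU1 ▸ hmono (mem_Ici.2 hx.1.le) (mem_Ici.2 zero_le_one) hx.2.le)
    (hU0 ▸ hmono self_mem_Ici (mem_Ici.2 hx.1.le) hx.1.le)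
  -- U is constant on (0,1), so U' = 0 there and F_ν vanishes on the segment; continuity then
  -- contradicts F_ν(0) > 0.
  have hF : EqOn (fun x : ℝ => besselSeries ν (x * z)) (fun _ => 0) (Ioo 0 1) := by
    intro x hx
    have h1 : U =ᶠ[nhds x] fun _ => 0 := by
      filter_upwards [isOpen_Ioo.mem_nhds hx] with y hy using hUz y hy
    have h2 := (hd x hx.1).unique ((hasDerivAt_const x (0 : ℝ)).congr_of_eventuallyEq h1)
    have h3 : z.im ^ 2 ≠ 0 := pow_ne_zero 2 him
    have h4 : x ^ ν ≠ 0 := (Real.rpow_pos_of_pos hx.1 ν).ne'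
    exact Complex.normSq_eq_zero.1
      ((mul_eq_zero.1 ((mul_eq_zero.1 h2).resolve_left h3)).resolve_left h4)
  have hcl := hF.closure (by have := continuous_besselSeries ν; fun_prop) continuous_const
  rw [closure_Ioo zero_ne_one] at hcl
  have h0 := hcl (left_mem_Icc.2 zero_le_one)
  simp only [Complex.ofReal_zero, zero_mul] at h0
  have hpos := besselSeriesReal_pos hν le_rfl
  rw [← Complex.ofReal_zero, ← ofReal_besselSeriesReal] at h0
  exact hpos.ne' (by exact_mod_cast h0)

lemma re_neg_of_besselSeries_eq_zero {ν : ℝ} (hν : -1 < ν) {z : ℂ}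
    (hz : besselSeries ν z = 0) : z.re < 0 := by
  by_contra! hre
  have h := besselSeriesReal_pos hν hre
  have hzr : ((z.re : ℝ) : ℂ) = z := Complex.ext rfl
    (by simp [im_eq_zero_of_besselSeries_eq_zero hν hz])
  rw [← hzr, ← ofReal_besselSeriesReal] at hz
  exact h.ne' (by exact_mod_cast hz)

/-! ### Riccati equation and monotonicity of the logarithmic derivative -/

lemma hasDerivAt_rpow_mul_of_eq {ν x b b' : ℝ} {B : ℝ → ℝ} (hx : 0 < x) (hb : B x = b)
    (hB : HasDerivAt B b' x) :
    HasDerivAt (fun x => x ^ (ν + 1) * B x) (x ^ ν * ((ν + 1) * b + x * b')) x := by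
  have h := (Real.hasDerivAt_rpow_const (p := ν + 1) (Or.inl hx.ne')).mul hB
  refine HasDerivAt.congr_deriv h ?_
  rw [add_sub_cancel_right, Real.rpow_add_one hx.ne', hb]
  ring

/-- The integrating factor x^{ν+1} vanishes at 0 because ν > -1, so x^{ν+1}B(x) increases from 0. -/
lemma nonneg_of_rpow_mul_deriv_nonneg {ν : ℝ} (hν : -1 < ν) {B B' : ℝ → ℝ}
    (hB : ∀ x, HasDerivAt B (B' x) x) (h : ∀ x, 0 < x → 0 ≤ (ν + 1) * B x + x * B' x)
    {x : ℝ} (hx : 0 < x) : 0 ≤ B x := by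
  have hcB : Continuous B := continuous_iff_continuousAt.2 fun x => (hB x).continuousAt
  have hc : Continuous fun x : ℝ => x ^ (ν + 1) * B x :=
    (continuous_id.rpow_const fun _ => Or.inr (by linarith)).mul hcB
  have hmono := monotoneOn_Ici_of_hasDerivAt_nonneg (a := 0) hc.continuousOn
    (fun x hx => hasDerivAt_rpow_mul_of_eq hx rfl (hB x))
    fun x hx => mul_nonneg (Real.rpow_nonneg (le_of_lt hx) _) (h x hx)
  have := hmono self_mem_Ici (mem_Ici.2 hx.le) hx.le
  simp only [Real.zero_rpow (by linarith : ν + 1 ≠ 0), zero_mul] at this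
  exact nonneg_of_mul_nonneg_right this (Real.rpow_pos_of_pos hx _)

lemma besselSeriesLogDeriv_pos {ν x : ℝ} (hν : -1 < ν) (hx : 0 ≤ x) :
    0 < besselSeriesLogDeriv ν x := by
  have h0 := besselSeriesReal_pos hν hx
  have h1 := besselSeriesReal_pos (by linarith : -1 < ν + 1) hx
  unfold besselSeriesLogDeriv
  positivity

lemma hasDerivAt_besselSeriesLogDeriv {ν x : ℝ} (hν : -1 < ν) (hx : 0 ≤ x) :
    HasDerivAt (besselSeriesLogDeriv ν)
      (besselSeriesReal (ν + 1 + 1) x / (16 * besselSeriesReal ν x) -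
        besselSeriesLogDeriv ν x ^ 2) x := by
  have h0 := besselSeriesReal_pos hν hx
  have h := (hasDerivAt_besselSeriesReal (ν + 1) x).div
    ((hasDerivAt_besselSeriesReal ν x).const_mul 4) (by positivity)
  refine HasDerivAt.congr_deriv h ?_
  rw [besselSeriesLogDeriv]
  field_simp
  ring

lemma continuousOn_besselSeriesLogDeriv {ν : ℝ} (hν : -1 < ν) :
    ContinuousOn (besselSeriesLogDeriv ν) (Ici 0) :=
  fun _ hx => (hasDerivAt_besselSeriesLogDeriv hν hx).continuousAt.continuousWithinAt

/-- Applied to B = F_ν²(1/4 - νg - xg²), the expression (ν+1)B + xB' collapses to F_ν²/4. By the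
Riccati equation the inequality says (xg)' ≥ 0. -/
lemma mul_sq_besselSeriesLogDeriv_add_le {ν x : ℝ} (hν : -1 < ν) (hx : 0 < x) :
    x * besselSeriesLogDeriv ν x ^ 2 + ν * besselSeriesLogDeriv ν x ≤ 1 / 4 := by
  have hB : ∀ x, HasDerivAt (fun x => besselSeriesReal ν x ^ 2 / 4
      - ν * besselSeriesReal ν x * besselSeriesReal (ν + 1) x / 4
      - x * besselSeriesReal (ν + 1) x ^ 2 / 16) _ x := fun x =>
    ((((hasDerivAt_besselSeriesReal ν x).pow 2).div_const 4).sub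
      ((((hasDerivAt_besselSeriesReal ν x).const_mul ν).mul
        (hasDerivAt_besselSeriesReal (ν + 1) x)).div_const 4)).sub
      (((hasDerivAt_id x).mul ((hasDerivAt_besselSeriesReal (ν + 1) x).pow 2)).div_const 16)
  have hpos := besselSeriesReal_pos hν hx.le
  have key := nonneg_of_rpow_mul_deriv_nonneg hν hB (fun x hx => by
    have h1 : x / 4 * besselSeriesReal (ν + 1 + 1) x =
        besselSeriesReal ν x - (ν + 1) * besselSeriesReal (ν + 1) x := by
      rw [besselSeriesReal_eq_add ν x]; ring
    have h2 : 0 ≤ besselSeriesReal ν x ^ 2 / 4 := by positivity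
    refine h2.trans_eq ?_
    simp only [id, Pi.pow_apply]
    norm_num
    linear_combination (x * besselSeriesReal (ν + 1) x / 8 + ν * besselSeriesReal ν x / 4) * h1)
    hx
  rw [besselSeriesLogDeriv, ← sub_nonneg]
  have : 1 / 4 - (x * (besselSeriesReal (ν + 1) x / (4 * besselSeriesReal ν x)) ^ 2 +
      ν * (besselSeriesReal (ν + 1) x / (4 * besselSeriesReal ν x))) =
      (besselSeriesReal ν x ^ 2 / 4
      - ν * besselSeriesReal ν x * besselSeriesReal (ν + 1) x / 4
      - x * besselSeriesReal (ν + 1) x ^ 2 / 16) / besselSeriesReal ν x ^ 2 := by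
    field_simp
    ring
  rw [this]
  exact div_nonneg key (sq_nonneg _)

/-- Here B = F_ν²(xg² + (ν+1)g - 1/4) and (ν+1)B + xB' = xF_{ν+1}²/16. By the Riccati equation the
inequality says g' ≤ 0. -/
lemma le_mul_sq_besselSeriesLogDeriv_add {ν x : ℝ} (hν : -1 < ν) (hx : 0 < x) :
    1 / 4 ≤ x * besselSeriesLogDeriv ν x ^ 2 + (ν + 1) * besselSeriesLogDeriv ν x := by
  have hB : ∀ x, HasDerivAt (fun x => x * besselSeriesReal (ν + 1) x ^ 2 / 16
      + (ν + 1) * besselSeriesReal ν x * besselSeriesReal (ν + 1) x / 4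
      - besselSeriesReal ν x ^ 2 / 4) _ x := fun x =>
    ((((hasDerivAt_id x).mul ((hasDerivAt_besselSeriesReal (ν + 1) x).pow 2)).div_const 16).add
      ((((hasDerivAt_besselSeriesReal ν x).const_mul (ν + 1)).mul
        (hasDerivAt_besselSeriesReal (ν + 1) x)).div_const 4)).sub
      (((hasDerivAt_besselSeriesReal ν x).pow 2).div_const 4)
  have hpos := besselSeriesReal_pos hν hx.le
  have key := nonneg_of_rpow_mul_deriv_nonneg hν hB (fun x hx => by
    have h1 : x / 4 * besselSeriesReal (ν + 1 + 1) x =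
        besselSeriesReal ν x - (ν + 1) * besselSeriesReal (ν + 1) x := by
      rw [besselSeriesReal_eq_add ν x]; ring
    have h2 : 0 ≤ x * besselSeriesReal (ν + 1) x ^ 2 / 16 := by positivity
    refine h2.trans_eq ?_
    simp only [id, Pi.pow_apply]
    norm_num
    linear_combination (-x * besselSeriesReal (ν + 1) x / 8
      - (ν + 1) * besselSeriesReal ν x / 4) * h1)
    hx
  rw [besselSeriesLogDeriv, ← sub_nonneg]
  have : x * (besselSeriesReal (ν + 1) x / (4 * besselSeriesReal ν x)) ^ 2 +
      (ν + 1) * (besselSeriesReal (ν + 1) x / (4 * besselSeriesReal ν x)) - 1 / 4 =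
      (x * besselSeriesReal (ν + 1) x ^ 2 / 16
      + (ν + 1) * besselSeriesReal ν x * besselSeriesReal (ν + 1) x / 4
      - besselSeriesReal ν x ^ 2 / 4) / besselSeriesReal ν x ^ 2 := by
    field_simp
    ring
  rw [this]
  exact div_nonneg key (sq_nonneg _)

lemma mul_deriv_besselSeriesLogDeriv {ν x : ℝ} (hν : -1 < ν) (hx : 0 ≤ x) :
    x * (besselSeriesReal (ν + 1 + 1) x / (16 * besselSeriesReal ν x) -
        besselSeriesLogDeriv ν x ^ 2) =
      1 / 4 - (ν + 1) * besselSeriesLogDeriv ν x - x * besselSeriesLogDeriv ν x ^ 2 := by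
  have h0 := besselSeriesReal_pos hν hx
  have h1 : x * besselSeriesReal (ν + 1 + 1) x =
      4 * (besselSeriesReal ν x - (ν + 1) * besselSeriesReal (ν + 1) x) := by
    rw [besselSeriesReal_eq_add ν x]; ring
  rw [mul_sub, ← mul_div_assoc, h1, besselSeriesLogDeriv]
  field_simp
  ring

lemma monotoneOn_mul_besselSeriesLogDeriv {ν : ℝ} (hν : -1 < ν) :
    MonotoneOn (fun x => x * besselSeriesLogDeriv ν x) (Ici 0) := by
  refine monotoneOn_Ici_of_hasDerivAt_nonneg
    (continuousOn_id.mul (continuousOn_besselSeriesLogDeriv hν))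
    (fun x hx => (hasDerivAt_id x).mul (hasDerivAt_besselSeriesLogDeriv hν (le_of_lt hx)))
    fun x hx => ?_
  have h1 := mul_deriv_besselSeriesLogDeriv hν (le_of_lt hx)
  have h2 := mul_sq_besselSeriesLogDeriv_add_le hν hx
  simp only [id, one_mul]
  rw [h1]
  linarith

lemma antitoneOn_besselSeriesLogDeriv {ν : ℝ} (hν : -1 < ν) :
    AntitoneOn (besselSeriesLogDeriv ν) (Ici 0) := by
  rw [← neg_neg (besselSeriesLogDeriv ν)]
  refine MonotoneOn.neg (monotoneOn_Ici_of_hasDerivAt_nonneg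
    (continuousOn_besselSeriesLogDeriv hν).neg
    (fun x hx => (hasDerivAt_besselSeriesLogDeriv hν (le_of_lt hx)).neg) fun x hx => ?_)
  have h1 := mul_deriv_besselSeriesLogDeriv hν (le_of_lt hx)
  have h2 := le_mul_sq_besselSeriesLogDeriv_add hν hx
  refine nonneg_of_mul_nonneg_right (a := x) ?_ hx
  rw [mul_neg, h1]
  linarith

lemma besselSeriesLogDeriv_le {ν x : ℝ} (hν : -1 < ν) (hx : 0 ≤ x) :
    besselSeriesLogDeriv ν x ≤ 1 / (4 * (ν + 1)) := by
  have h0 := besselSeriesReal_pos hν hx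
  have h2 := besselSeriesReal_pos (by linarith : -1 < ν + 1 + 1) hx
  have h3 : 0 ≤ x / 4 * besselSeriesReal (ν + 1 + 1) x := by positivity
  have h4 : 0 < ν + 1 := by linarith
  rw [besselSeriesLogDeriv, div_le_div_iff₀ (by positivity) (by positivity)]
  linarith [besselSeriesReal_eq_add ν x]

lemma exists_besselSeriesLogDeriv_le_div_sqrt {ν : ℝ} (hν : -1 < ν) :
    ∃ C, 0 < C ∧ ∀ x, 0 < x → besselSeriesLogDeriv ν x ≤ C / √x := by
  have h4 : 0 < ν + 1 := by linarith
  refine ⟨√(1 / 4 + |ν| * (1 / (4 * (ν + 1)))), Real.sqrt_pos.2 (by positivity), fun x hx => ?_⟩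
  rw [le_div_iff₀ (Real.sqrt_pos.2 hx)]
  refine Real.le_sqrt_of_sq_le ?_
  have h1 := mul_sq_besselSeriesLogDeriv_add_le hν hx
  have h2 := besselSeriesLogDeriv_le hν hx.le
  have h3 := besselSeriesLogDeriv_pos hν hx.le
  rw [mul_pow, Real.sq_sqrt hx.le]
  have h5 := mul_le_mul_of_nonneg_left h2 (abs_nonneg ν)
  have h6 := mul_le_mul_of_nonneg_right (neg_le_abs ν) h3.le
  linarith

lemma exists_div_sqrt_le_besselSeriesLogDeriv {ν : ℝ} (hν : -1 < ν) :
    ∃ c, 0 < c ∧ ∀ x, 1 ≤ x → c / √x ≤ besselSeriesLogDeriv ν x := by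
  obtain ⟨C, hC, hg⟩ := exists_besselSeriesLogDeriv_le_div_sqrt hν
  have h4 : 0 < ν + 1 := by linarith
  -- With t = g√x ≤ C and g ≤ t for x ≥ 1, the lower quadratic inequality gives 1/4 ≤ t² + (ν+1)g ≤
  -- (C+ν+1)t.
  refine ⟨1 / (4 * (C + (ν + 1))), by positivity, fun x hx => ?_⟩
  have hx0 : 0 < x := by linarith
  have hs : 1 ≤ √x := Real.one_le_sqrt.2 hx
  have h1 := le_mul_sq_besselSeriesLogDeriv_add hν hx0
  have h3 := besselSeriesLogDeriv_pos hν hx0.le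
  have h5 := (le_div_iff₀ (by linarith)).1 (hg x hx0)
  rw [div_div, div_le_iff₀ (by positivity)]
  have h6 : x * besselSeriesLogDeriv ν x ^ 2 =
      (besselSeriesLogDeriv ν x * √x) * (besselSeriesLogDeriv ν x * √x) := by
    nlinarith [Real.sq_sqrt hx0.le]
  have h7 : 0 < besselSeriesLogDeriv ν x * √x := by positivity
  have h8 : besselSeriesLogDeriv ν x ≤ besselSeriesLogDeriv ν x * √x :=
    le_mul_of_one_le_right h3.le hs
  have h9 := mul_le_mul_of_nonneg_left h5 h7.le
  have h10 := mul_le_mul_of_nonneg_left h8 h4.le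
  nlinarith

/-! ### The integral inequality for g decreasing and x g(x) increasing -/

lemma intervalIntegrable_mul_rpow_neg {g : ℝ → ℝ} (hc : ContinuousOn g (Ici 0)) {ρ a b : ℝ}
    (hρ : ρ < 1) (ha : 0 ≤ a) (hb : 0 ≤ b) :
    IntervalIntegrable (fun x => g x * x ^ (-ρ)) volume a b :=
  (intervalIntegral.intervalIntegrable_rpow' (by linarith)).continuousOn_mul
    (hc.mono fun _ hx => (le_min ha hb).trans hx.1)

lemma intervalIntegrable_of_continuousOn_Ici {g : ℝ → ℝ} (hc : ContinuousOn g (Ici 0)) {a b : ℝ}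
    (ha : 0 ≤ a) (hb : 0 ≤ b) : IntervalIntegrable g volume a b :=
  (hc.mono fun _ hx => (le_min ha hb).trans hx.1).intervalIntegrable

/-- Chebyshev's integral inequality for two decreasing functions: c is the mean of x^{-ρ} over
(0,s), and y is the point where x^{-ρ} equals c, so g(x) - g(y) and x^{-ρ} - c have the same sign.
-/
lemma le_integral_zero_mul_rpow_neg {g : ℝ → ℝ} (hc : ContinuousOn g (Ici 0))
    (hg : AntitoneOn g (Ici 0)) {ρ s : ℝ} (hρ0 : 0 < ρ) (hρ : ρ < 1) (hs : 0 < s) :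
    s ^ (-ρ) / (1 - ρ) * ∫ x in (0 : ℝ)..s, g x ≤ ∫ x in (0 : ℝ)..s, g x * x ^ (-ρ) := by
  have h1ρ : 0 < 1 - ρ := by linarith
  set c := s ^ (-ρ) / (1 - ρ) with hc'
  have hcpos : 0 < c := by positivity
  set y := c ^ (-ρ⁻¹) with hy
  have hypos : 0 < y := by positivity
  have hyc : y ^ (-ρ) = c := by
    rw [hy, ← Real.rpow_mul hcpos.le, neg_mul_neg, inv_mul_cancel₀ hρ0.ne', Real.rpow_one]
  have hig := intervalIntegrable_of_continuousOn_Ici hc le_rfl hs.le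
  have higr := intervalIntegrable_mul_rpow_neg hc hρ le_rfl hs.le
  have hir : IntervalIntegrable (fun x : ℝ => x ^ (-ρ)) volume 0 s :=
    intervalIntegral.intervalIntegrable_rpow' (by linarith)
  have hzero : ∫ x in (0 : ℝ)..s, g y * (x ^ (-ρ) - c) = 0 := by
    rw [intervalIntegral.integral_const_mul, intervalIntegral.integral_sub hir (by simp),
      integral_rpow (Or.inl (by linarith)), intervalIntegral.integral_const,
      Real.zero_rpow (by linarith), hc', Real.rpow_add_one hs.ne', smul_eq_mul,
      show -ρ + 1 = 1 - ρ by ring]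
    ring
  have hle : ∫ x in (0 : ℝ)..s, g y * (x ^ (-ρ) - c) ≤
      ∫ x in (0 : ℝ)..s, (g x * x ^ (-ρ) - c * g x) := by
    refine intervalIntegral.integral_mono_on_of_le_Ioo hs.le
      ((hir.sub (by simp)).const_mul _) (higr.sub (hig.const_mul c)) fun x hx => ?_
    have hx0 : 0 < x := hx.1
    have : 0 ≤ (g x - g y) * (x ^ (-ρ) - c) := by
      rcases le_total x y with h | h
      · exact mul_nonneg (sub_nonneg.2 (hg (mem_Ici.2 hx0.le) (mem_Ici.2 hypos.le) h))
          (sub_nonneg.2 (hyc ▸ Real.rpow_le_rpow_of_nonpos hx0 h (by linarith)))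
      · exact mul_nonneg_of_nonpos_of_nonpos
          (sub_nonpos.2 (hg (mem_Ici.2 hypos.le) (mem_Ici.2 hx0.le) h))
          (sub_nonpos.2 (hyc ▸ Real.rpow_le_rpow_of_nonpos hypos h (by linarith)))
    linarith
  rw [hzero, intervalIntegral.integral_sub higr (hig.const_mul c),
    intervalIntegral.integral_const_mul] at hle
  linarith

lemma le_integral_Ioi_mul_rpow_neg {g : ℝ → ℝ} (hm : MonotoneOn (fun x => x * g x) (Ici 0))
    {ρ r : ℝ} (hρ0 : 0 < ρ) (hr : 0 < r)
    (hi : IntegrableOn (fun x => g x * x ^ (-ρ)) (Ioi 0)) :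
    r ^ (-ρ) * (r * g r / ρ) ≤ ∫ x in Ioi r, g x * x ^ (-ρ) := by
  have h1 : ∫ x in Ioi r, r * g r * x ^ (-ρ - 1) = r ^ (-ρ) * (r * g r / ρ) := by
    rw [integral_const_mul, integral_Ioi_rpow_of_lt (by linarith) hr]
    simp only [sub_add_cancel, neg_div_neg_eq]
    ring
  rw [← h1]
  refine setIntegral_mono_on ((integrableOn_Ioi_rpow_of_lt (by linarith) hr).const_mul _)
    (hi.mono_set (Ioi_subset_Ioi hr.le)) measurableSet_Ioi fun x hx => ?_
  have hx0 : 0 < x := hr.trans hx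
  have h2 : r * g r ≤ x * g x := hm (mem_Ici.2 hr.le) (mem_Ici.2 hx0.le) (le_of_lt hx)
  calc r * g r * x ^ (-ρ - 1) ≤ x * g x * x ^ (-ρ - 1) := by gcongr
    _ = g x * x ^ (-ρ) := by rw [Real.rpow_sub_one hx0.ne']; field_simp

lemma le_integral_mul_rpow_neg {g : ℝ → ℝ} (hc : ContinuousOn g (Ici 0))
    (hg0 : ∀ x, 0 ≤ x → 0 ≤ g x) {ρ a b : ℝ} (hρ0 : 0 < ρ) (hρ : ρ < 1) (ha : 0 < a)
    (hab : a ≤ b) :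
    b ^ (-ρ) * ∫ x in a..b, g x ≤ ∫ x in a..b, g x * x ^ (-ρ) := by
  have hb : 0 < b := ha.trans_le hab
  rw [← intervalIntegral.integral_const_mul]
  refine intervalIntegral.integral_mono_on hab
    ((intervalIntegrable_of_continuousOn_Ici hc ha.le hb.le).const_mul _)
    (intervalIntegrable_mul_rpow_neg hc hρ ha.le hb.le) fun x hx => ?_
  rw [mul_comm]
  have hx0 : 0 < x := ha.trans_le hx.1
  exact mul_le_mul_of_nonneg_left
    (Real.rpow_le_rpow_of_nonpos hx0 hx.2 (by linarith)) (hg0 x hx0.le)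

lemma integral_le_mul_log {g : ℝ → ℝ} (hc : ContinuousOn g (Ici 0))
    (hm : MonotoneOn (fun x => x * g x) (Ici 0)) {a b : ℝ} (ha : 0 < a) (hab : a ≤ b) :
    ∫ x in a..b, g x ≤ b * g b * Real.log (b / a) := by
  have hb : 0 < b := ha.trans_le hab
  rw [← integral_inv_of_pos ha hb, ← intervalIntegral.integral_const_mul]
  refine intervalIntegral.integral_mono_on hab
    (intervalIntegrable_of_continuousOn_Ici hc ha.le hb.le)
    ((intervalIntegral.intervalIntegrable_inv (fun x hx => ?_) continuousOn_id).const_mul _)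
    fun x hx => ?_
  · rw [uIcc_of_le hab] at hx
    exact (ha.trans_le hx.1).ne'
  · have hx0 : 0 < x := ha.trans_le hx.1
    rw [← div_eq_mul_inv, le_div_iff₀ hx0, mul_comm]
    exact hm (mem_Ici.2 hx0.le) (mem_Ici.2 hb.le) hx.2

lemma exp_one_div_rpow_self {ρ : ℝ} (hρ0 : 0 < ρ) :
    (Real.exp 1 / ρ) ^ ρ = Real.exp (ρ * (1 - Real.log ρ)) := by
  rw [Real.rpow_def_of_pos (by positivity), Real.log_div (by positivity) hρ0.ne', Real.log_exp,
    mul_comm]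

lemma exp_one_div_rpow_self_le {ρ : ℝ} (hρ0 : 0 < ρ) : (Real.exp 1 / ρ) ^ ρ ≤ 3 := by
  rw [exp_one_div_rpow_self hρ0]
  have h1 := Real.one_sub_inv_le_log_of_pos hρ0
  have h2 : ρ * (1 - ρ⁻¹) ≤ ρ * Real.log ρ := by gcongr
  have h3 : ρ * ρ⁻¹ = 1 := mul_inv_cancel₀ hρ0.ne'
  calc Real.exp (ρ * (1 - Real.log ρ)) ≤ Real.exp 1 := Real.exp_le_exp.2 (by linarith)
    _ ≤ 3 := by linarith [Real.exp_one_lt_d9]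

/-- Tangent-line bounds for exp and log, both touching at ρ = 1/2, reduce the claim to a linear
inequality in ρ that holds at 1/2 with room to spare, since log 2 > 1/2, and improves as ρ grows. -/
lemma exp_one_div_rpow_self_le_exp_half_div {ρ : ℝ} (hρ0 : 1 / 2 < ρ) (hρ : ρ < 1) :
    (Real.exp 1 / ρ) ^ ρ ≤ Real.exp (ρ / 2) / (1 - ρ) := by
  have h0 : 0 < ρ := by linarith
  have hl2 := Real.log_two_lt_d9
  have h1 : 1 - ρ ≤ Real.exp (1 - 2 * ρ - Real.log 2) := by
    rw [Real.exp_sub, Real.exp_log two_pos, le_div_iff₀ two_pos]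
    linarith [Real.add_one_le_exp (1 - 2 * ρ)]
  have h2 : 1 - (2 * ρ)⁻¹ ≤ Real.log 2 + Real.log ρ := by
    rw [← Real.log_mul two_ne_zero h0.ne']
    exact Real.one_sub_inv_le_log_of_pos (by positivity)
  have h3 : ρ * (1 - (2 * ρ)⁻¹) ≤ ρ * (Real.log 2 + Real.log ρ) := by gcongr
  have h4 : ρ * (2 * ρ)⁻¹ = 1 / 2 := by field_simp
  rw [exp_one_div_rpow_self h0, le_div_iff₀ (by linarith)]
  calc Real.exp (ρ * (1 - Real.log ρ)) * (1 - ρ)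
      ≤ Real.exp (ρ * (1 - Real.log ρ)) * Real.exp (1 - 2 * ρ - Real.log 2) := by gcongr
    _ = Real.exp (ρ * (1 - Real.log ρ) + (1 - 2 * ρ - Real.log 2)) := (Real.exp_add _ _).symm
    _ ≤ Real.exp (ρ / 2) := Real.exp_le_exp.2 (by
        nlinarith [Real.log_two_gt_d9, mul_pos (sub_pos.2 hρ0) (by linarith : 0 < 5 / 2 - Real.log 2)])

lemma Gamma_one_add_le_one {ρ : ℝ} (h0 : 0 ≤ ρ) (h1 : ρ ≤ 1) : Real.Gamma (1 + ρ) ≤ 1 := by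
  have h := Real.convexOn_Gamma.2 (x := 1) (y := 2) (by simp) (by simp)
    (by linarith : 0 ≤ 1 - ρ) h0 (by ring)
  simp only [smul_eq_mul, Real.Gamma_one, Real.Gamma_two] at h
  rw [show 1 + ρ = (1 - ρ) * 1 + ρ * 2 by ring]
  linarith

/-- If `g ≥ 0` decreases and `x g(x)` increases, then `∫₀ʳ g` is controlled by
`∫₀^∞ g(x) x^(-ρ) dx`. -/
lemma integral_le_of_antitoneOn_of_monotoneOn {g : ℝ → ℝ} (hc : ContinuousOn g (Ici 0))
    (hg0 : ∀ x, 0 ≤ x → 0 ≤ g x) (hg : AntitoneOn g (Ici 0))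
    (hm : MonotoneOn (fun x => x * g x) (Ici 0)) {ρ r : ℝ} (hρ0 : 1 / 2 < ρ) (hρ : ρ < 1)
    (hr : 0 < r) (hi : IntegrableOn (fun x => g x * x ^ (-ρ)) (Ioi 0)) :
    ∫ x in (0 : ℝ)..r, g x ≤
      (ρ / Real.exp 1) ^ ρ / Real.Gamma (1 + ρ) * (∫ x in Ioi 0, g x * x ^ (-ρ)) * r ^ ρ := by
  have h0 : 0 < ρ := by linarith
  have h1ρ : 0 < 1 - ρ := by linarith
  -- This split point makes log(r/s) = 1/2, hence 2D ≤ r g(r). The tail over (r,∞) then supplies 2D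
  -- and the middle piece D, and 3D ≥ QD. The head carries s^{-ρ} = e^{ρ/2} r^{-ρ}, which matches
  -- the bound Q ≤ e^{ρ/2}/(1-ρ).
  set s := Real.exp (-(1 / 2)) * r with hs
  have hspos : 0 < s := by positivity
  have hsr : s ≤ r := mul_le_of_le_one_left hr.le (Real.exp_le_one_iff.2 (by norm_num))
  set A := ∫ x in (0 : ℝ)..s, g x with hA
  set D := ∫ x in s..r, g x with hD
  set Q := (Real.exp 1 / ρ) ^ ρ with hQ
  have hQpos : 0 < Q := by positivity
  have hA0 : 0 ≤ A := intervalIntegral.integral_nonneg hspos.le fun x hx => hg0 x hx.1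
  have hD0 : 0 ≤ D := intervalIntegral.integral_nonneg hsr fun x hx => hg0 x (hspos.le.trans hx.1)
  have hsum : ∫ x in (0 : ℝ)..r, g x = A + D :=
    (intervalIntegral.integral_add_adjacent_intervals
      (intervalIntegrable_of_continuousOn_Ici hc le_rfl hspos.le)
      (intervalIntegrable_of_continuousOn_Ici hc hspos.le hr.le)).symm
  have hhead := le_integral_zero_mul_rpow_neg hc hg h0 hρ hspos
  have hmid := le_integral_mul_rpow_neg hc hg0 h0 hρ hspos hsr
  have htail := le_integral_Ioi_mul_rpow_neg hm h0 hr hi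
  have hDle := integral_le_mul_log hc hm hspos hsr
  have hlog : Real.log (r / s) = 1 / 2 := by
    rw [hs, div_mul_cancel_right₀ hr.ne', ← Real.exp_neg, Real.log_exp, neg_neg]
  rw [hlog] at hDle
  have hspow : s ^ (-ρ) = Real.exp (ρ / 2) * r ^ (-ρ) := by
    rw [hs, Real.mul_rpow (Real.exp_pos _).le hr.le, ← Real.exp_mul]
    ring_nf
  have hsplit : ∫ x in Ioi 0, g x * x ^ (-ρ) =
      (∫ x in (0 : ℝ)..s, g x * x ^ (-ρ)) + (∫ x in s..r, g x * x ^ (-ρ)) +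
        ∫ x in Ioi r, g x * x ^ (-ρ) := by
    rw [intervalIntegral.integral_add_adjacent_intervals
      (intervalIntegrable_mul_rpow_neg hc hρ le_rfl hspos.le)
      (intervalIntegrable_mul_rpow_neg hc hρ hspos.le hr.le),
      intervalIntegral.integral_of_le hr.le, ← Ioc_union_Ioi_eq_Ioi hr.le]
    exact setIntegral_union (Ioc_disjoint_Ioi le_rfl) measurableSet_Ioi
      (hi.mono_set Ioc_subset_Ioi_self) (hi.mono_set (Ioi_subset_Ioi hr.le))
  have hrpow : 0 < r ^ (-ρ) := by positivity
  have hmain : r ^ (-ρ) * (Q * (A + D)) ≤ ∫ x in Ioi 0, g x * x ^ (-ρ) := by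
    have e1 : Q * A ≤ Real.exp (ρ / 2) / (1 - ρ) * A :=
      mul_le_mul_of_nonneg_right (exp_one_div_rpow_self_le_exp_half_div hρ0 hρ) hA0
    have e2 : Q * D ≤ 3 * D := mul_le_mul_of_nonneg_right (exp_one_div_rpow_self_le h0) hD0
    have e3 : 2 * D ≤ r * g r / ρ := by
      rw [le_div_iff₀ h0]
      nlinarith
    have e4 : Q * (A + D) ≤ Real.exp (ρ / 2) / (1 - ρ) * A + D + r * g r / ρ := by linarith
    have e5 := mul_le_mul_of_nonneg_left e4 hrpow.le
    have e6 : s ^ (-ρ) / (1 - ρ) * A = r ^ (-ρ) * (Real.exp (ρ / 2) / (1 - ρ) * A) := by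
      rw [hspow]; ring
    rw [e6] at hhead
    rw [hsplit]
    linarith
  have hG := Gamma_one_add_le_one h0.le hρ.le
  have hGpos : 0 < Real.Gamma (1 + ρ) := Real.Gamma_pos_of_pos (by linarith)
  have hKQ : (ρ / Real.exp 1) ^ ρ * Q = 1 := by
    rw [hQ, ← Real.mul_rpow (by positivity) (by positivity), div_mul_div_cancel₀ (by positivity),
      div_self h0.ne', Real.one_rpow]
  have hrr : r ^ (-ρ) * r ^ ρ = 1 := by
    rw [← Real.rpow_add hr, neg_add_cancel, Real.rpow_zero]
  have hK : 0 < (ρ / Real.exp 1) ^ ρ := by positivity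
  calc ∫ x in (0 : ℝ)..r, g x = (ρ / Real.exp 1) ^ ρ * (r ^ (-ρ) * (Q * (A + D))) * r ^ ρ := by
        rw [hsum]
        linear_combination (-(A + D) * (r ^ (-ρ) * r ^ ρ)) * hKQ - (A + D) * hrr
    _ ≤ (ρ / Real.exp 1) ^ ρ * (∫ x in Ioi 0, g x * x ^ (-ρ)) * r ^ ρ := by gcongr
    _ ≤ (ρ / Real.exp 1) ^ ρ / Real.Gamma (1 + ρ) * (∫ x in Ioi 0, g x * x ^ (-ρ)) * r ^ ρ := by
        have hI : 0 ≤ ∫ x in Ioi 0, g x * x ^ (-ρ) :=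
          le_trans (by positivity) hmain
        gcongr
        exact le_div_self hK.le hGpos hG

/-! ### Integrability, growth and order -/

lemma hasDerivAt_log_besselSeriesReal {ν x : ℝ} (hν : -1 < ν) (hx : 0 ≤ x) :
    HasDerivAt (fun x => Real.log (besselSeriesReal ν x)) (besselSeriesLogDeriv ν x) x := by
  refine HasDerivAt.congr_deriv
    ((hasDerivAt_besselSeriesReal ν x).log (besselSeriesReal_pos hν hx).ne') ?_
  rw [besselSeriesLogDeriv, div_div]

lemma continuousOn_log_besselSeriesReal {ν : ℝ} (hν : -1 < ν) :
    ContinuousOn (fun x => Real.log (besselSeriesReal ν x)) (Ici 0) :=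
  fun _ hx => (hasDerivAt_log_besselSeriesReal hν hx).continuousAt.continuousWithinAt

lemma integral_besselSeriesLogDeriv {ν r : ℝ} (hν : -1 < ν) (hr : 0 ≤ r) :
    ∫ x in (0 : ℝ)..r, besselSeriesLogDeriv ν x =
      Real.log (Real.Gamma (ν + 1) * besselSeriesReal ν r) := by
  have hG : 0 < Real.Gamma (ν + 1) := Real.Gamma_pos_of_pos (by linarith)
  rw [intervalIntegral.integral_eq_sub_of_hasDerivAt
    (fun x hx => hasDerivAt_log_besselSeriesReal hν (by rw [uIcc_of_le hr] at hx; exact hx.1))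
    (intervalIntegrable_of_continuousOn_Ici (continuousOn_besselSeriesLogDeriv hν) le_rfl hr),
    besselSeriesReal_zero, Real.log_mul hG.ne' (besselSeriesReal_pos hν hr).ne', one_div,
    Real.log_inv]
  ring

/-- Near 0, g is continuous and ρ < 1; near infinity, g = O(x^{-1/2}) and ρ > 1/2. -/
lemma integrableOn_besselSeriesLogDeriv_mul_rpow {ν ρ : ℝ} (hν : -1 < ν) (hρ0 : 1 / 2 < ρ)
    (hρ : ρ < 1) : IntegrableOn (fun x => besselSeriesLogDeriv ν x * x ^ (-ρ)) (Ioi 0) := by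
  have hc := continuousOn_besselSeriesLogDeriv hν
  obtain ⟨C, hC, hg⟩ := exists_besselSeriesLogDeriv_le_div_sqrt hν
  rw [← Ioc_union_Ioi_eq_Ioi zero_le_one]
  refine IntegrableOn.union ?_ ?_
  · exact (intervalIntegrable_iff_integrableOn_Ioc_of_le zero_le_one).1
      (intervalIntegrable_mul_rpow_neg hc hρ le_rfl zero_le_one)
  · have hsub : Ioi (1 : ℝ) ⊆ Ioi 0 := Ioi_subset_Ioi zero_le_one
    refine Integrable.mono' ((integrableOn_Ioi_rpow_of_lt
      (by linarith : -(1 / 2) - ρ < -1) one_pos).const_mul C) ?_ ?_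
    · refine ContinuousOn.aestronglyMeasurable (ContinuousOn.mul
        (hc.mono (hsub.trans Ioi_subset_Ici_self)) ?_) measurableSet_Ioi
      exact continuousOn_id.rpow_const fun x hx => Or.inl (ne_of_gt (hsub hx))
    · refine (ae_restrict_iff' measurableSet_Ioi).2 (ae_of_all _ fun x hx => ?_)
      have hx0 : 0 < x := hsub hx
      have h1 := besselSeriesLogDeriv_pos hν hx0.le
      rw [Real.norm_of_nonneg (by positivity)]
      calc besselSeriesLogDeriv ν x * x ^ (-ρ) ≤ C / √x * x ^ (-ρ) := by gcongr; exact hg x hx0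
        _ = C * x ^ (-(1 / 2) - ρ) := by
          rw [sub_eq_add_neg (-(1 / 2)) ρ, Real.rpow_add hx0, Real.rpow_neg hx0.le (1 / 2),
            ← Real.sqrt_eq_rpow]
          ring

lemma exists_log_besselSeriesReal_le {ν : ℝ} (hν : -1 < ν) :
    ∃ C, 0 < C ∧ ∀ᶠ x in atTop, Real.log (besselSeriesReal ν x) ≤ C * √x := by
  obtain ⟨C, hC, hg⟩ := exists_besselSeriesLogDeriv_le_div_sqrt hν
  have hmono : MonotoneOn (fun x => 2 * C * √x - Real.log (besselSeriesReal ν x)) (Ici 0) := by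
    refine monotoneOn_Ici_of_hasDerivAt_nonneg
      ((Real.continuous_sqrt.const_mul _).continuousOn.sub (continuousOn_log_besselSeriesReal hν))
      (fun x hx => ((Real.hasDerivAt_sqrt (ne_of_gt hx)).const_mul (2 * C)).sub
        (hasDerivAt_log_besselSeriesReal hν (le_of_lt hx))) fun x hx => ?_
    have h := hg x hx
    have h2 : 2 * C * (1 / (2 * √x)) = C / √x := by field_simp
    rw [h2]
    linarith
  -- The extra √x absorbs the constant log F_ν(0).
  refine ⟨2 * C + 1, by positivity, ?_⟩
  filter_upwards [eventually_ge_atTop 0,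
    Real.tendsto_sqrt_atTop.eventually_ge_atTop (Real.log (besselSeriesReal ν 0))] with x hx hx1
  have := hmono self_mem_Ici (mem_Ici.2 hx) hx
  simp only [Real.sqrt_zero, mul_zero, zero_sub] at this
  linarith

lemma exists_le_log_besselSeriesReal {ν : ℝ} (hν : -1 < ν) :
    ∃ c, 0 < c ∧ ∀ᶠ x in atTop, c * √x ≤ Real.log (besselSeriesReal ν x) := by
  obtain ⟨c, hc, hg⟩ := exists_div_sqrt_le_besselSeriesLogDeriv hν
  have hmono : MonotoneOn (fun x => Real.log (besselSeriesReal ν x) - 2 * c * √x) (Ici 1) := by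
    refine monotoneOn_Ici_of_hasDerivAt_nonneg
      (((continuousOn_log_besselSeriesReal hν).mono (Ici_subset_Ici.2 zero_le_one)).sub
        (Real.continuous_sqrt.const_mul _).continuousOn)
      (fun x hx => (hasDerivAt_log_besselSeriesReal hν (by linarith)).sub
        ((Real.hasDerivAt_sqrt (by linarith)).const_mul (2 * c))) fun x hx => ?_
    have h := hg x (le_of_lt hx)
    have h2 : 2 * c * (1 / (2 * √x)) = c / √x := by field_simp
    rw [h2]
    linarith
  refine ⟨c, hc, ?_⟩
  filter_upwards [eventually_ge_atTop 1,
    (Real.tendsto_sqrt_atTop.const_mul_atTop hc).eventually_ge_atTop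
      (2 * c - Real.log (besselSeriesReal ν 1))] with x hx hx1
  have := hmono self_mem_Ici (mem_Ici.2 hx) hx
  simp only [Real.sqrt_one, mul_one] at this
  linarith

/-- Positive coefficients put the maximum over the disc at the point r. -/
lemma sSup_norm_besselSeries {ν r : ℝ} (hν : -1 < ν) (hr : 0 ≤ r) :
    sSup ((fun z : ℂ => ‖besselSeries ν z‖) '' Metric.closedBall 0 r) = besselSeriesReal ν r := by
  have hmono : MonotoneOn (besselSeriesReal ν) (Ici 0) :=
    monotoneOn_Ici_of_hasDerivAt_nonneg (continuous_besselSeriesReal ν).continuousOn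
      (fun x _ => hasDerivAt_besselSeriesReal ν x) fun x hx =>
      div_nonneg (besselSeriesReal_pos (by linarith) (le_of_lt hx)).le (by norm_num)
  refine IsGreatest.csSup_eq ⟨⟨r, ?_, norm_besselSeries_ofReal hν hr⟩, ?_⟩
  · simp [abs_of_nonneg hr]
  · rintro _ ⟨z, hz, rfl⟩
    have hz' : ‖z‖ ≤ r := by simpa using hz
    exact (norm_besselSeries_le hν z).trans (hmono (norm_nonneg z) hr hz')

lemma tendsto_log_mul_sqrt_div_log {c : ℝ} (hc : 0 < c) :
    Tendsto (fun r : ℝ => Real.log (c * √r) / Real.log r) atTop (nhds (1 / 2)) := by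
  have h1 : Tendsto (fun r : ℝ => Real.log c / Real.log r + 1 / 2) atTop (nhds (0 + 1 / 2)) :=
    (Real.tendsto_log_atTop.const_div_atTop _).add_const _
  rw [zero_add] at h1
  refine h1.congr' ?_
  filter_upwards [eventually_gt_atTop 1] with r hr
  have hl : Real.log r ≠ 0 := (Real.log_pos hr).ne'
  rw [Real.log_mul hc.ne' (Real.sqrt_pos.2 (by linarith)).ne', Real.log_sqrt (by linarith)]
  field_simp

lemma entireOrder_besselSeries {ν : ℝ} (hν : -1 < ν) :
    entireOrder (besselSeries ν) = ((1 / 2 : ℝ) : EReal) := by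
  obtain ⟨C, hC, hupper⟩ := exists_log_besselSeriesReal_le hν
  obtain ⟨c, hc, hlower⟩ := exists_le_log_besselSeriesReal hν
  refine Tendsto.limsup_eq ((continuous_coe_real_ereal.tendsto _).comp ?_)
  refine tendsto_of_tendsto_of_tendsto_of_le_of_le' (tendsto_log_mul_sqrt_div_log hc)
    (tendsto_log_mul_sqrt_div_log hC) ?_ ?_
  · filter_upwards [hlower, eventually_gt_atTop 1] with r h hr
    have hs : 0 < √r := Real.sqrt_pos.2 (by linarith)
    rw [sSup_norm_besselSeries hν (by linarith)]
    exact div_le_div_of_nonneg_right (Real.log_le_log (by positivity) h) (Real.log_pos hr).le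
  · filter_upwards [hlower, hupper, eventually_gt_atTop 1] with r h h' hr
    have hs : 0 < √r := Real.sqrt_pos.2 (by linarith)
    rw [sSup_norm_besselSeries hν (by linarith)]
    exact div_le_div_of_nonneg_right (Real.log_le_log ((by positivity : 0 < c * √r).trans_le h) h')
      (Real.log_pos hr).le

/-! ### The exponential bound and the theorem -/

lemma div_rpow_eq_besselSeriesLogDeriv_mul {ν : ℝ} (hν : -1 < ν) (ρ : ℝ) :
    EqOn (fun x => besselSeriesLogDeriv ν x * x ^ (-ρ)) (fun x => besselILogDeriv ν x / x ^ ρ)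
      (Ioi 0) := by
  intro x hx
  simp only
  rw [besselILogDeriv_eq hν hx, Real.rpow_neg (le_of_lt hx), div_eq_mul_inv]

lemma Gamma_mul_norm_besselSeries_le {ν ρ : ℝ} (hν : -1 < ν) (hρ0 : 1 / 2 < ρ) (hρ : ρ < 1)
    {z : ℂ} (hz : |z.arg| < Real.pi / 2) :
    Real.Gamma (ν + 1) * ‖besselSeries ν z‖ ≤ Real.exp (besselIBoundCoeff ρ ν z * ‖z‖ ^ ρ) := by
  have hG : 0 < Real.Gamma (ν + 1) := Real.Gamma_pos_of_pos (by linarith)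
  -- At z = 0 both sides equal 1; the integral inequality needs a positive radius.
  rcases eq_or_ne z 0 with rfl | hz0
  · rw [besselSeries_zero, norm_zero, Real.zero_rpow (by linarith), mul_zero, Real.exp_zero,
      ← Complex.ofReal_one, ← Complex.ofReal_add, Complex.Gamma_ofReal, ← Complex.ofReal_div,
      Complex.norm_of_nonneg (by positivity), mul_one_div_cancel hG.ne']
  have hr : 0 < ‖z‖ := norm_pos_iff.2 hz0
  have hR := besselSeriesReal_pos hν hr.le
  have hi := integrableOn_besselSeriesLogDeriv_mul_rpow hν hρ0 hρ
  have hmain := integral_le_of_antitoneOn_of_monotoneOn (continuousOn_besselSeriesLogDeriv hν)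
    (fun x hx => (besselSeriesLogDeriv_pos hν hx).le) (antitoneOn_besselSeriesLogDeriv hν)
    (monotoneOn_mul_besselSeriesLogDeriv hν) hρ0 hρ hr hi
  rw [integral_besselSeriesLogDeriv hν hr.le] at hmain
  have hI : 0 ≤ ∫ x in Ioi 0, besselSeriesLogDeriv ν x * x ^ (-ρ) :=
    setIntegral_nonneg measurableSet_Ioi fun x hx =>
      mul_nonneg (besselSeriesLogDeriv_pos hν (le_of_lt hx)).le (Real.rpow_nonneg (le_of_lt hx) _)
  have hcos : 0 < Real.cos z.arg := Real.cos_pos_of_mem_Ioo ⟨(abs_lt.1 hz).1, (abs_lt.1 hz).2⟩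
  have hGρ : 0 < Real.Gamma (1 + ρ) := Real.Gamma_pos_of_pos (by linarith)
  have hcos1 : Real.cos z.arg ^ (1 - ρ) ≤ 1 :=
    Real.rpow_le_one hcos.le (Real.cos_le_one _) (by linarith)
  have hcos0 : 0 < Real.cos z.arg ^ (1 - ρ) := Real.rpow_pos_of_pos hcos _
  have hρ' : 0 < ρ := by linarith
  calc Real.Gamma (ν + 1) * ‖besselSeries ν z‖
      ≤ Real.Gamma (ν + 1) * besselSeriesReal ν ‖z‖ := by
        gcongr; exact norm_besselSeries_le hν z
    _ = Real.exp (Real.log (Real.Gamma (ν + 1) * besselSeriesReal ν ‖z‖)) :=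
        (Real.exp_log (by positivity)).symm
    _ ≤ Real.exp (besselIBoundCoeff ρ ν z * ‖z‖ ^ ρ) := by
        rw [Real.exp_le_exp, besselIBoundCoeff, ← setIntegral_congr_fun measurableSet_Ioi
          (div_rpow_eq_besselSeriesLogDeriv_mul hν ρ)]
        refine hmain.trans ?_
        gcongr
        exact mul_le_of_le_one_left hGρ.le hcos1

theorem mainTheorem2 (ν : ℝ) (hν : -1 < ν) :
    Differentiable ℂ (besselIQuot ν) ∧
    entireOrder (besselIQuot ν) = ((1 / 2 : ℝ) : EReal) ∧
    (∀ z : ℂ, besselIQuot ν z = 0 → z.im = 0 ∧ z.re < 0) ∧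
    (∀ x : ℝ, 0 < x →
      (besselILogDeriv ν x : ℂ) =
          besselI (ν - 1) (√x : ℝ) / (2 * (√x : ℝ) * besselI ν (√x : ℝ)) - ν / x ∧
        logDeriv (besselIQuot ν) (x : ℂ) = (besselILogDeriv ν x : ℂ)) ∧
    ∀ ρ : ℝ, 1 / 2 < ρ → ρ < 1 →
      IntegrableOn (fun x : ℝ => besselILogDeriv ν x / x ^ ρ) (Ioi 0) ∧
      ∀ z : ℂ, |z.arg| < Real.pi / 2 →
        1 ≤ Real.Gamma (ν + 1) * ‖besselIQuot ν z‖ ∧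
        Real.Gamma (ν + 1) * ‖besselIQuot ν z‖ ≤
          Real.exp (besselIBoundCoeff ρ ν z * ‖z‖ ^ ρ) := by
  rw [besselIQuot_eq]
  refine ⟨fun z => (hasDerivAt_besselSeries ν z).differentiableAt, entireOrder_besselSeries hν,
    fun z hz => ⟨im_eq_zero_of_besselSeries_eq_zero hν hz, re_neg_of_besselSeries_eq_zero hν hz⟩,
    fun x hx => ⟨?_, ?_⟩, fun ρ hρ0 hρ => ⟨?_, fun z hz => ⟨?_, ?_⟩⟩⟩
  · rw [besselILogDeriv_eq hν hx, besselI_div_sub_eq hν hx]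
  · rw [besselILogDeriv_eq hν hx, logDeriv_besselSeries_ofReal]
  · exact (integrableOn_besselSeriesLogDeriv_mul_rpow hν hρ0 hρ).congr_fun
      (div_rpow_eq_besselSeriesLogDeriv_mul hν ρ) measurableSet_Ioi
  · have hre : 0 ≤ z.re := by
      rcases Complex.abs_arg_lt_pi_div_two_iff.1 hz with h | rfl
      · exact h.le
      · simp
    have hG : 0 < Real.Gamma (ν + 1) := Real.Gamma_pos_of_pos (by linarith)
    have h0 : ‖besselSeries ν 0‖ = 1 / Real.Gamma (ν + 1) := by
      have := norm_besselSeries_ofReal hν le_rfl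
      rwa [Complex.ofReal_zero, besselSeriesReal_zero] at this
    have h1 := norm_besselSeries_zero_le hν hre
    rwa [h0, div_le_iff₀' hG] at h1
  · exact Gamma_mul_norm_besselSeries_le hν hρ0 hρ hz
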